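/- Let $A\in\mathbb R^{n\times n}$, $B\in\mathbb R^{n\times m}$, $x_0\in\mathbb R^n$, let $N$ be a horizon, $\mathscr T=\{0,\dots,N-1\}$, let $Q_0,\dots,Q_N\in\mathbb R^{n\times n}$ be symmetric positive semidefinite and $R_0,\dots,R_{N-1}\in\mathbb R^{m\times m}$ symmetric positive definite. For $\mathscr S\subseteq\mathscr T$ let $$J(\mathscr S)=\min\Big\{x_N^\top Q_Nx_N+\sum_{k=0}^{N-1}\big(x_k^\top Q_kx_k+u_k^\top R_ku_k\big)\;:\;x_{k+1}=Ax_k+Bu_k,\ u_k=0\text{ for }k\notin\mathscr S\Big\}$$ and $f(\mathscr S)=J(\emptyset)-J(\mathscr S)$. Put $\bar Q=\mathrm{diag}\{Q_1,\dots,Q_N\}$, $\bar R=\mathrm{diag}\{R_0,\dots,R_{N-1}\}$, $\bar B=I_N\otimes B$; let $\Phi$ be the $N\times N$ block lower triangular matrix with $(i,j)$ block $A^{i-j}$ for $j\le i$ and $0$ for $j>i$, and $\Psi=[A^\top,(A^2)^\top,\dots,(A^N)^\top]^\top$. For $\mathscr S\subseteq\mathscr T$ let $\tilde S\in\mathbb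 R^{|\mathscr S|\times N}$ consist of the rows of $I_N$ that correspond to the elements of $\mathscr S$, in ascending order, and $S=\tilde S\otimes I_m$. Define $$L=\bar Q^{1/2}\Psi x_0x_0^\top\Psi^\top\bar Q^{1/2},\qquad K(\mathscr S)=\bar Q^{1/2}\Phi\bar B\,S^\top S\bar R^{-1}S^\top S\,\bar B^\top\Phi^\top\bar Q^{1/2},$$ $$\underline\gamma=\frac{\min_{\omega\in\mathscr T}\mathrm{tr}[LK(\{\omega\})]\,\big\{\min_{\omega\in\mathscr T}\lambda_{\min}[I+K(\{\omega\})]\big\}^2}{\max_{\omega\in\mathscr T}\mathrm{tr}[LK(\{\omega\})]\,\big\{\lambda_{\max}[I+K(\mathscr T)]\big\}^2},\qquad \overline\alpha=1-\underline\gamma,$$ where $\lambda_{\min}$ and $\lambda_{\max}$ are the smallest and the largest eigenvalue of a symmetric matrix and $I=I_{Nn}$. Suppose that $\mathrm{tr}[LK(\{\omega\})]\ne0$ for some $\omega\in\mathscr T$. Let $0\le d\le N$, let $\mathscr S^g$ be the set returned by the greedy algorithm, which starts from $\emptyset$ and $d$ times adds an element $\omega$ outside of the current set $\mathscr S$ that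 maximizes $f(\mathscr S\cup\{\omega\})-f(\mathscr S)$ (ties broken arbitrarily), and let $\mathscr S^*$ maximize $f(\mathscr S)$ subject to $|\mathscr S|\le d$. Then $$f(\mathscr S^g)\ \ge\ \frac1{\overline\alpha}\Big(1-e^{-\overline\alpha\,\underline\gamma}\Big)f(\mathscr S^*),$$ where for $\overline\alpha=0$ the factor is read as its limit $\underline\gamma$. -/

import Mathlib

open scoped Matrix Kronecker MatrixOrder

noncomputable section

namespace SparseLQR

/-- The data of a finite-horizon LQR problem with state dimension `n`, input dimension `m` and
horizon `N`: the system `x_{k+1} = A x_k + B u_k`, the state weights `Q_0, …, Q_N`, the input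
weights `R_0, …, R_{N-1}` and the initial state `x_0`. -/
structure Problem (n m N : ℕ) where
  A : Matrix (Fin n) (Fin n) ℝ
  B : Matrix (Fin n) (Fin m) ℝ
  Q : Fin (N + 1) → Matrix (Fin n) (Fin n) ℝ
  R : Fin N → Matrix (Fin m) (Fin m) ℝ
  x0 : Fin n → ℝ

variable {n m N : ℕ}

/-! ### The optimal cost -/

/-- The trajectory `x_0, …, x_N` generated by the input sequence `u_0, …, u_{N-1}`. -/
def Problem.traj (P : Problem n m N) (u : Fin N → Fin m → ℝ) (k : Fin (N + 1)) : Fin n → ℝ :=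
  Fin.induction (motive := fun _ => Fin n → ℝ) P.x0 (fun i x => P.A *ᵥ x + P.B *ᵥ u i) k

/-- The quadratic cost
`x_Nᵀ Q_N x_N + ∑_{k=0}^{N-1} (x_kᵀ Q_k x_k + u_kᵀ R_k u_k)` of an input sequence. -/
def Problem.cost (P : Problem n m N) (u : Fin N → Fin m → ℝ) : ℝ :=
  P.traj u (Fin.last N) ⬝ᵥ (P.Q (Fin.last N) *ᵥ P.traj u (Fin.last N)) +
    ∑ k : Fin N, (P.traj u k.castSucc ⬝ᵥ (P.Q k.castSucc *ᵥ P.traj u k.castSucc) +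
      u k ⬝ᵥ (P.R k *ᵥ u k))

/-- The costs that can be reached with inputs that vanish outside the time instants in `S`. -/
def Problem.costs (P : Problem n m N) (S : Finset (Fin N)) : Set ℝ :=
  {c | ∃ u : Fin N → Fin m → ℝ, (∀ k, k ∉ S → u k = 0) ∧ c = P.cost u}

/-- The optimal LQR cost `J(S)`: the least cost over all inputs that vanish outside `S`.
For `Q_k ⪰ 0` and `R_k ≻ 0` the set of costs is nonempty and bounded below, as shown next. -/
def Problem.J (P : Problem n m N) (S : Finset (Fin N)) : ℝ := sInf (P.costs S)

theorem Problem.costs_nonempty (P : Problem n m N) (S : Finset (Fin N)) :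
    (P.costs S).Nonempty :=
  ⟨P.cost 0, 0, fun _ _ => rfl, rfl⟩

theorem Problem.costs_bddBelow (P : Problem n m N) (hQ : ∀ k, (P.Q k).PosSemidef)
    (hR : ∀ k, (P.R k).PosDef) (S : Finset (Fin N)) : BddBelow (P.costs S) := by
  refine ⟨0, ?_⟩
  rintro c ⟨u, -, rfl⟩
  have hq : ∀ k (x : Fin n → ℝ), 0 ≤ x ⬝ᵥ (P.Q k *ᵥ x) := fun k x => by
    simpa using (hQ k).dotProduct_mulVec_nonneg x
  have hr : ∀ k (x : Fin m → ℝ), 0 ≤ x ⬝ᵥ (P.R k *ᵥ x) := fun k x => by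
    simpa using (hR k).posSemidef.dotProduct_mulVec_nonneg x
  exact add_nonneg (hq _ _) (Finset.sum_nonneg fun k _ => add_nonneg (hq _ _) (hr _ _))

/-- The objective `f(S) = -J(S) + J(∅)` of the equivalent maximization problem. -/
def Problem.f (P : Problem n m N) (S : Finset (Fin N)) : ℝ := -P.J S + P.J ∅

/-! ### The matrices of the explicit cost formula

Vectors in `ℝ^{Nn}` and `ℝ^{Nm}` are indexed by `Fin N × Fin n` and `Fin N × Fin m`; the first
coordinate is the number of the block, counted from `0`. -/

/-- The block diagonal matrix with diagonal blocks `D_0, …, D_{N-1}`. -/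
def blockDiag {p q : ℕ} (D : Fin N → Matrix (Fin p) (Fin q) ℝ) :
    Matrix (Fin N × Fin p) (Fin N × Fin q) ℝ :=
  (Matrix.blockDiagonal D).submatrix Prod.swap Prod.swap

/-- `Q̄ = diag{Q_1, …, Q_N}`. -/
def Problem.Qbar (P : Problem n m N) : Matrix (Fin N × Fin n) (Fin N × Fin n) ℝ :=
  blockDiag fun k : Fin N => P.Q k.succ

/-- The positive semidefinite square root of `Q̄`. -/
def Problem.sqrtQbar (P : Problem n m N) : Matrix (Fin N × Fin n) (Fin N × Fin n) ℝ :=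
  CFC.sqrt P.Qbar

/-- `R̄ = diag{R_0, …, R_{N-1}}`. -/
def Problem.Rbar (P : Problem n m N) : Matrix (Fin N × Fin m) (Fin N × Fin m) ℝ :=
  blockDiag P.R

/-- `B̄ = I_N ⊗ B`. -/
def Problem.Bbar (P : Problem n m N) : Matrix (Fin N × Fin n) (Fin N × Fin m) ℝ :=
  (1 : Matrix (Fin N) (Fin N) ℝ) ⊗ₖ P.B

/-- The lower block triangular matrix `Φ` with blocks `A^{i-j}` for `j ≤ i`. -/
def Problem.Phi (P : Problem n m N) : Matrix (Fin N × Fin n) (Fin N × Fin n) ℝ :=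
  Matrix.of fun i j =>
    if j.1 ≤ i.1 then (P.A ^ ((i.1 : ℕ) - (j.1 : ℕ))) i.2 j.2 else 0

/-- The block column `Ψ` with blocks `A, A^2, …, A^N`. -/
def Problem.Psi (P : Problem n m N) : Matrix (Fin N × Fin n) (Fin n) ℝ :=
  Matrix.of fun i j => (P.A ^ ((i.1 : ℕ) + 1)) i.2 j

/-- The `|S| × N` selection matrix: its `i`-th row is the unit row vector at the `i`-th element
of `S` in ascending order. -/
def selection (S : Finset (Fin N)) : Matrix (Fin S.card) (Fin N) ℝ :=
  Matrix.of fun i j => if j = S.orderEmbOfFin rfl i then 1 else 0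

/-- The `|S|m × Nm` scheduling matrix, the Kronecker product of the selection matrix and `I_m`. -/
def scheduling (m : ℕ) (S : Finset (Fin N)) :
    Matrix (Fin S.card × Fin m) (Fin N × Fin m) ℝ :=
  selection S ⊗ₖ (1 : Matrix (Fin m) (Fin m) ℝ)

/-- `L = Q̄^{1/2} Ψ x_0 x_0ᵀ Ψᵀ Q̄^{1/2}`. -/
def Problem.L (P : Problem n m N) : Matrix (Fin N × Fin n) (Fin N × Fin n) ℝ :=
  P.sqrtQbar * P.Psi * Matrix.vecMulVec P.x0 P.x0 * P.Psiᵀ * P.sqrtQbar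

/-- `K(S) = Q̄^{1/2} Φ B̄ SᵀS R̄⁻¹ SᵀS B̄ᵀ Φᵀ Q̄^{1/2}`, with `S` the scheduling matrix. -/
def Problem.K (P : Problem n m N) (S : Finset (Fin N)) :
    Matrix (Fin N × Fin n) (Fin N × Fin n) ℝ :=
  P.sqrtQbar * P.Phi * P.Bbar * ((scheduling m S)ᵀ * scheduling m S) * P.Rbar⁻¹ *
    ((scheduling m S)ᵀ * scheduling m S) * P.Bbarᵀ * P.Phiᵀ * P.sqrtQbar

/-! ### The approximation factor -/

/-- The largest eigenvalue of a real symmetric matrix. -/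
def maxEigenvalue {ι : Type*} [Fintype ι] [DecidableEq ι] (M : Matrix ι ι ℝ) : ℝ :=
  sSup (spectrum ℝ M)

/-- The smallest eigenvalue of a real symmetric matrix. -/
def minEigenvalue {ι : Type*} [Fintype ι] [DecidableEq ι] (M : Matrix ι ι ℝ) : ℝ :=
  sInf (spectrum ℝ M)

/-- The lower bound on the submodularity ratio. Infima and suprema are over the finite set of
all time instants. -/
def Problem.gammaLow (P : Problem n m N) : ℝ :=
  ((⨅ ω : Fin N, (P.L * P.K {ω}).trace) * (⨅ ω : Fin N, minEigenvalue (1 + P.K {ω})) ^ 2) /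
    ((⨆ ω : Fin N, (P.L * P.K {ω}).trace) * maxEigenvalue (1 + P.K Finset.univ) ^ 2)

/-- The upper bound on the curvature. -/
def Problem.alphaUp (P : Problem n m N) : ℝ := 1 - P.gammaLow

/-- The factor `(1/α) (1 - e^{-αγ})`. At `α = 0` it is read as its limit `γ`. -/
def approxFactor (α γ : ℝ) : ℝ :=
  if α = 0 then γ else 1 / α * (1 - Real.exp (-(α * γ)))

/-! ### The greedy algorithm -/

/-- `GreedyRun f i S`: the greedy algorithm for maximizing `f`, with ties broken in some way, can
hold the set `S` after `i` iterations. It starts from `∅`, and every iteration adds an element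
outside of the current set whose marginal gain is maximal among all such elements. -/
inductive GreedyRun (f : Finset (Fin N) → ℝ) : ℕ → Finset (Fin N) → Prop
  | init : GreedyRun f 0 ∅
  | step {i : ℕ} {S : Finset (Fin N)} {ω : Fin N} (hS : GreedyRun f i S) (hω : ω ∉ S)
      (hmax : ∀ ω', ω' ∉ S → f (S ∪ {ω'}) - f S ≤ f (S ∪ {ω}) - f S) :
      GreedyRun f (i + 1) (S ∪ {ω})

/-- `S` is an optimal solution of: maximize `f(S)` subject to `|S| ≤ d`. -/
def IsOptimal (f : Finset (Fin N) → ℝ) (d : ℕ) (S : Finset (Fin N)) : Prop :=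
  S.card ≤ d ∧ ∀ T : Finset (Fin N), T.card ≤ d → f T ≤ f S

end SparseLQR

end

/-!
Write `v = Q̄^{1/2} Ψ x_0`, `G = Q̄^{1/2} Φ B̄`, and let `E(S)` be the block diagonal matrix with blocks
`R_k⁻¹` for `k ∈ S` and `0` otherwise. Up to the constant `x_0ᵀ Q_0 x_0`, the cost of an input `u` is
`‖v + G u‖² + uᵀ R̄ u`, and `K(S) = G E(S) Gᵀ = ∑_{ω ∈ S} K({ω})`. Hence
`f(S) = vᵀ v - vᵀ (1 + K(S))⁻¹ v`, and `tr[L K(S)] = vᵀ K(S) v` is its first-order approximation,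
which is additive in `S`.

Let `Λ` be the largest eigenvalue of `1 + K(𝒯)`, where `𝒯` is the set of all time instants, and
`μ` the minimum over `ω` of the smallest eigenvalue of `1 + K({ω})`. As `K` is monotone,
`μ ≤ 1 + K(S) ≤ Λ` for nonempty `S`, which yields the sandwich
`tr[L K(S)] / Λ ≤ f(S) ≤ tr[L K(S)] / μ` (`Problem.le_f`, `Problem.f_le`). The lower bound comes
from one explicit input, a gradient step of length `1 / Λ`; the upper bound comes from weak
duality. Neither needs the closed form of `f`.

With `a` and `b` the minimum and the maximum of `tr[L K({ω})]`, a set `S` of cardinality `d` has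
`f(S) ≥ d a / Λ`, while an optimal set has `f(S*) ≤ d b / μ`. The ratio of these two bounds is
`(a / b) (μ / Λ) ≥ (a / b) (μ / Λ)² = γ`, so *every* set of cardinality `d` attains the fraction `γ`
of the optimum (`Problem.gammaLow_mul_le`). Finally `(1 / α) (1 - e^{-α γ}) ≤ γ` for `α ≥ 0`, so the
claimed factor is no larger than `γ` (`approxFactor_le`). Only the cardinality of the greedy set
enters, not the order in which its elements are chosen.
-/

open scoped Matrix Kronecker MatrixOrder

noncomputable section

namespace SparseLQR

open Matrix

/-! ### Quadratic forms and weak duality -/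

section QuadraticForms

variable {ι κ : Type*} [Fintype ι] [Fintype κ]

theorem dotProduct_mulVec_nonneg_of_nonneg {M : Matrix ι ι ℝ} (hM : 0 ≤ M) (x : ι → ℝ) :
    0 ≤ x ⬝ᵥ (M *ᵥ x) := by
  simpa using (Matrix.nonneg_iff_posSemidef.1 hM).dotProduct_mulVec_nonneg x

theorem dotProduct_mulVec_comm_of_transpose_eq {M : Matrix ι ι ℝ} (hM : Mᵀ = M) (x y : ι → ℝ) :
    x ⬝ᵥ (M *ᵥ y) = y ⬝ᵥ (M *ᵥ x) := by
  rw [dotProduct_mulVec, ← mulVec_transpose, hM, dotProduct_comm]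

omit [Fintype ι] in
theorem transpose_eq_of_nonneg {M : Matrix ι ι ℝ} (hM : 0 ≤ M) : Mᵀ = M := by
  simpa [Matrix.IsHermitian] using (Matrix.nonneg_iff_posSemidef.1 hM).isHermitian

theorem le_maxEigenvalue_smul_one [DecidableEq ι] {M : Matrix ι ι ℝ} (hM : M.IsHermitian) :
    M ≤ maxEigenvalue M • (1 : Matrix ι ι ℝ) := by
  rw [← Algebra.algebraMap_eq_smul_one]
  exact le_algebraMap_of_spectrum_le
    (fun x hx => le_csSup (M.finite_real_spectrum).bddAbove hx) hM.isSelfAdjoint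

theorem minEigenvalue_smul_one_le [DecidableEq ι] {M : Matrix ι ι ℝ} (hM : M.IsHermitian) :
    minEigenvalue M • (1 : Matrix ι ι ℝ) ≤ M := by
  rw [← Algebra.algebraMap_eq_smul_one]
  exact algebraMap_le_of_le_spectrum
    (fun x hx => csInf_le (M.finite_real_spectrum).bddBelow hx) hM.isSelfAdjoint

/-- Weak duality between inputs `u` and dual variables `y`, by completing squares. The matrix `E`
plays the role of the inverse of `R` on the admissible inputs, which is what `hu` expresses. -/
theorem dual_le_cost [DecidableEq ι] (G : Matrix ι κ ℝ) {R E : Matrix κ κ ℝ} (hR : 0 ≤ R)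
    (hE : Eᵀ = E) (hERE : E * R * E = E) (v y : ι → ℝ) (u : κ → ℝ)
    (hu : E *ᵥ (R *ᵥ u) = u) :
    2 * (y ⬝ᵥ v) - y ⬝ᵥ ((1 + G * E * Gᵀ) *ᵥ y) ≤
      (v + G *ᵥ u) ⬝ᵥ (v + G *ᵥ u) + u ⬝ᵥ (R *ᵥ u) := by
  have hRT := transpose_eq_of_nonneg hR
  set p := Gᵀ *ᵥ y with hp
  have h1 : y ⬝ᵥ ((1 + G * E * Gᵀ) *ᵥ y) = y ⬝ᵥ y + p ⬝ᵥ (E *ᵥ p) := by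
    rw [add_mulVec, one_mulVec, dotProduct_add, ← mulVec_mulVec, ← mulVec_mulVec, ← hp,
      dotProduct_mulVec, ← mulVec_transpose]
  have h2 : y ⬝ᵥ (G *ᵥ u) = p ⬝ᵥ u := by
    rw [dotProduct_mulVec, ← mulVec_transpose]
  have h3 : u ⬝ᵥ (R *ᵥ (E *ᵥ p)) = p ⬝ᵥ u := by
    rw [dotProduct_mulVec_comm_of_transpose_eq hRT, dotProduct_comm,
      dotProduct_mulVec_comm_of_transpose_eq hE, hu]
  have h4 : (E *ᵥ p) ⬝ᵥ (R *ᵥ (E *ᵥ p)) = p ⬝ᵥ (E *ᵥ p) := by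
    rw [dotProduct_comm, dotProduct_mulVec_comm_of_transpose_eq hE, mulVec_mulVec, mulVec_mulVec,
      hERE]
  -- The duality gap is `‖v + G u - y‖² + (u + E p)ᵀ R (u + E p)`.
  have h5 := dotProduct_mulVec_nonneg_of_nonneg hR (u + E *ᵥ p)
  have h6 : (E *ᵥ p) ⬝ᵥ (R *ᵥ u) = p ⬝ᵥ u := by
    rw [← h3, dotProduct_mulVec_comm_of_transpose_eq hRT]
  have h7 : 0 ≤ (v + G *ᵥ u - y) ⬝ᵥ (v + G *ᵥ u - y) :=
    Finset.sum_nonneg fun _ _ => mul_self_nonneg _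
  have h8 : y ⬝ᵥ (v + G *ᵥ u) = y ⬝ᵥ v + p ⬝ᵥ u := by rw [dotProduct_add, h2]
  rw [sub_dotProduct, dotProduct_sub, dotProduct_sub, dotProduct_comm _ y, h8] at h7
  rw [mulVec_add, add_dotProduct, dotProduct_add, dotProduct_add, h3, h4, h6] at h5
  linarith

/-- The cost of the scaled gradient input `u = -c E Gᵀ v`. -/
theorem cost_gradient_input [DecidableEq ι] (G : Matrix ι κ ℝ) {R E : Matrix κ κ ℝ}
    (hE : Eᵀ = E) (hERE : E * R * E = E) (v : ι → ℝ) (c : ℝ) :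
    (v + G *ᵥ (-c • E *ᵥ (Gᵀ *ᵥ v))) ⬝ᵥ (v + G *ᵥ (-c • E *ᵥ (Gᵀ *ᵥ v))) +
        (-c • E *ᵥ (Gᵀ *ᵥ v)) ⬝ᵥ (R *ᵥ (-c • E *ᵥ (Gᵀ *ᵥ v))) =
      v ⬝ᵥ v - 2 * c * (v ⬝ᵥ ((G * E * Gᵀ) *ᵥ v)) +
        c ^ 2 * (v ⬝ᵥ ((G * E * Gᵀ * (1 + G * E * Gᵀ)) *ᵥ v)) := by
  have hKT : (G * E * Gᵀ)ᵀ = G * E * Gᵀ := by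
    simp [transpose_mul, hE, Matrix.mul_assoc]
  have h1 : G *ᵥ (E *ᵥ (Gᵀ *ᵥ v)) = (G * E * Gᵀ) *ᵥ v := by simp [mulVec_mulVec, Matrix.mul_assoc]
  have h2 : (E *ᵥ (Gᵀ *ᵥ v)) ⬝ᵥ (R *ᵥ (E *ᵥ (Gᵀ *ᵥ v))) = v ⬝ᵥ ((G * E * Gᵀ) *ᵥ v) := by
    rw [dotProduct_comm, dotProduct_mulVec_comm_of_transpose_eq hE, mulVec_mulVec, mulVec_mulVec,
      hERE, ← h1, dotProduct_mulVec v, ← mulVec_transpose]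
  have h3 : ((G * E * Gᵀ) *ᵥ v) ⬝ᵥ ((G * E * Gᵀ) *ᵥ v) =
      v ⬝ᵥ ((G * E * Gᵀ * (G * E * Gᵀ)) *ᵥ v) := by
    rw [← mulVec_mulVec v (G * E * Gᵀ), dotProduct_mulVec_comm_of_transpose_eq hKT v]
  simp only [neg_smul, mulVec_neg, mulVec_smul, h1, mul_add, mul_one, add_mulVec, dotProduct_add,
    add_dotProduct, dotProduct_neg, neg_dotProduct, dotProduct_smul, smul_dotProduct, smul_eq_mul,
    h2, h3, dotProduct_comm _ v]
  ring

section Bounds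

variable [DecidableEq ι] {K : Matrix ι ι ℝ}

/-- If `μ ≤ 1 + K`, then `vᵀ (1 + K)⁻¹ v ≥ vᵀ v - vᵀ K v / μ`. The left side enters as the value
of the dual function at its maximizer `(1 + K)⁻¹ v`. -/
theorem exists_dual_ge (hK : 0 ≤ K) {μ : ℝ} (hμ : 0 < μ)
    (h : μ • (1 : Matrix ι ι ℝ) ≤ 1 + K) (v : ι → ℝ) :
    ∃ y : ι → ℝ, v ⬝ᵥ v - (v ⬝ᵥ (K *ᵥ v)) / μ ≤ 2 * (y ⬝ᵥ v) - y ⬝ᵥ ((1 + K) *ᵥ y) := by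
  have hpd : (1 + K).PosDef := Matrix.PosDef.one.add_posSemidef (Matrix.nonneg_iff_posSemidef.1 hK)
  have hdet : IsUnit (1 + K).det := (Matrix.isUnit_iff_isUnit_det _).1 hpd.isUnit
  have hMT : (1 + K)ᵀ = 1 + K := transpose_eq_of_nonneg (nonneg_iff_posSemidef.2 hpd.posSemidef)
  obtain ⟨w, rfl⟩ : ∃ w, (1 + K) *ᵥ w = v :=
    ⟨(1 + K)⁻¹ *ᵥ v, by rw [mulVec_mulVec, mul_nonsing_inv _ hdet, one_mulVec]⟩
  refine ⟨w, ?_⟩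
  have hcomm : Commute K (1 + K - μ • 1) := by
    simp only [commute_iff_eq]; noncomm_ring
  -- With `v = (1 + K) w`, the claim is `wᵀ (1 + K) K (1 + K - μ) w ≥ 0`.
  have h1 : 0 ≤ K * (1 + K - μ • 1) := Commute.mul_nonneg hK (sub_nonneg.2 h) hcomm
  have h2 : 0 ≤ (1 + K) * (K * (1 + K - μ • 1)) := by
    refine Commute.mul_nonneg (nonneg_iff_posSemidef.2 hpd.posSemidef) h1 ?_
    exact (((Commute.one_left K).add_left (.refl K)).mul_right
      (((Commute.refl (1 + K))).sub_right ((Commute.one_right _).smul_right μ)))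
  have h3 := dotProduct_mulVec_nonneg_of_nonneg h2 w
  have e : (1 + K) * (K * (1 + K - μ • 1)) =
      (1 + K) * (K * (1 + K)) - μ • ((1 + K) * (1 + K)) + μ • (1 + K) := by
    simp only [mul_sub, mul_add, add_mul, mul_smul_comm, mul_one, one_mul, smul_add]
    abel
  have hx : ∀ z, ((1 + K) *ᵥ w) ⬝ᵥ z = w ⬝ᵥ ((1 + K) *ᵥ z) := fun z => by
    rw [dotProduct_comm, dotProduct_mulVec_comm_of_transpose_eq hMT]
  rw [e, add_mulVec, sub_mulVec, smul_mulVec, smul_mulVec, dotProduct_add, dotProduct_sub,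
    dotProduct_smul, dotProduct_smul, smul_eq_mul, smul_eq_mul] at h3
  rw [hx, hx, mulVec_mulVec, mulVec_mulVec, mulVec_mulVec]
  have h4 : w ⬝ᵥ (((1 + K) * (1 + K)) *ᵥ w) - w ⬝ᵥ ((1 + K) *ᵥ w) ≤
      (w ⬝ᵥ (((1 + K) * (K * (1 + K))) *ᵥ w)) / μ := by
    rw [le_div_iff₀ hμ]; linarith
  rw [Matrix.mul_assoc]
  linarith

/-- If `1 + K ≤ Λ`, then the gradient step of length `1 / Λ` decreases the cost by at least
`vᵀ K v / Λ`. -/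
theorem gradient_step_le (hK : 0 ≤ K) {Λ : ℝ} (hΛ : 0 < Λ)
    (h : 1 + K ≤ Λ • (1 : Matrix ι ι ℝ)) (v : ι → ℝ) :
    v ⬝ᵥ v - 2 * Λ⁻¹ * (v ⬝ᵥ (K *ᵥ v)) + Λ⁻¹ ^ 2 * (v ⬝ᵥ ((K * (1 + K)) *ᵥ v)) ≤
      v ⬝ᵥ v - (v ⬝ᵥ (K *ᵥ v)) / Λ := by
  have h1 : 0 ≤ K * (Λ • 1 - (1 + K)) := by
    refine Commute.mul_nonneg hK (sub_nonneg.2 h) ?_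
    simp only [commute_iff_eq]; noncomm_ring
  have h2 := dotProduct_mulVec_nonneg_of_nonneg h1 v
  rw [mul_sub, mul_smul_comm, mul_one, sub_mulVec, smul_mulVec, dotProduct_sub, dotProduct_smul,
    smul_eq_mul] at h2
  have h3 : Λ⁻¹ ^ 2 * (v ⬝ᵥ ((K * (1 + K)) *ᵥ v)) ≤ Λ⁻¹ ^ 2 * (Λ * (v ⬝ᵥ (K *ᵥ v))) := by
    gcongr; linarith
  have h4 : Λ⁻¹ ^ 2 * (Λ * (v ⬝ᵥ (K *ᵥ v))) = (v ⬝ᵥ (K *ᵥ v)) / Λ := by field_simp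
  have h5 : 2 * Λ⁻¹ * (v ⬝ᵥ (K *ᵥ v)) = 2 * ((v ⬝ᵥ (K *ᵥ v)) / Λ) := by ring
  linarith

end Bounds
end QuadraticForms

/-! ### Block diagonal matrices and the selection of time instants -/

variable {n m N : ℕ}

section BlockDiag
variable {p q r : ℕ}

theorem blockDiag_apply (D : Fin N → Matrix (Fin p) (Fin q) ℝ) (i : Fin N × Fin p)
    (j : Fin N × Fin q) : blockDiag D i j = if i.1 = j.1 then D i.1 i.2 j.2 else 0 := by
  simp [blockDiag, blockDiagonal_apply]

theorem blockDiag_mul (D : Fin N → Matrix (Fin p) (Fin q) ℝ)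
    (E : Fin N → Matrix (Fin q) (Fin r) ℝ) :
    blockDiag D * blockDiag E = blockDiag fun k => D k * E k := by
  have h : (blockDiagonal D).submatrix (Prod.swap : Fin N × Fin p → _)
        (Equiv.prodComm (Fin N) (Fin q)) *
      (blockDiagonal E).submatrix (Equiv.prodComm (Fin N) (Fin q)) (Prod.swap : Fin N × Fin r → _) =
      (blockDiagonal fun k => D k * E k).submatrix Prod.swap Prod.swap := by
    rw [submatrix_mul_equiv, blockDiagonal_mul]
  exact h

theorem blockDiag_mulVec (D : Fin N → Matrix (Fin p) (Fin q) ℝ) (x : Fin N × Fin q → ℝ)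
    (i : Fin N × Fin p) : (blockDiag D *ᵥ x) i = (D i.1 *ᵥ fun j => x (i.1, j)) i.2 := by
  simp [mulVec, dotProduct, Fintype.sum_prod_type, blockDiag_apply, Finset.sum_ite_irrel]

theorem dotProduct_blockDiag_mulVec (D : Fin N → Matrix (Fin p) (Fin p) ℝ) (x : Fin N × Fin p → ℝ) :
    x ⬝ᵥ (blockDiag D *ᵥ x) = ∑ k, (fun j => x (k, j)) ⬝ᵥ (D k *ᵥ fun j => x (k, j)) := by
  simp only [dotProduct, Fintype.sum_prod_type, blockDiag_mulVec]

theorem blockDiag_one : blockDiag (fun _ : Fin N => (1 : Matrix (Fin p) (Fin p) ℝ)) = 1 := by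
  ext i j
  simp only [blockDiag_apply, one_apply, Prod.ext_iff]
  split_ifs <;> simp_all

theorem blockDiag_transpose (D : Fin N → Matrix (Fin p) (Fin q) ℝ) :
    (blockDiag D)ᵀ = blockDiag fun k => (D k)ᵀ := by
  ext i j
  simp only [transpose_apply, blockDiag_apply, eq_comm (a := j.1)]
  split_ifs with h <;> simp [h]

theorem blockDiag_posSemidef {D : Fin N → Matrix (Fin p) (Fin p) ℝ} (hD : ∀ k, (D k).PosSemidef) :
    (blockDiag D).PosSemidef := by
  refine .of_dotProduct_mulVec_nonneg ?_ fun x => ?_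
  · rw [IsHermitian, conjTranspose_eq_transpose_of_trivial, blockDiag_transpose]
    congr 1; ext1 k
    simpa [IsHermitian] using (hD k).isHermitian
  · rw [star_trivial, dotProduct_blockDiag_mulVec]
    exact Finset.sum_nonneg fun k _ => by simpa using (hD k).dotProduct_mulVec_nonneg _

theorem blockDiag_inv {D : Fin N → Matrix (Fin p) (Fin p) ℝ} (hD : ∀ k, IsUnit (D k).det) :
    (blockDiag D)⁻¹ = blockDiag fun k => (D k)⁻¹ := by
  refine inv_eq_right_inv ?_
  rw [blockDiag_mul, ← blockDiag_one]
  congr 1; ext1 k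
  exact mul_nonsing_inv _ (hD k)

theorem scheduling_transpose_mul_self (m : ℕ) (S : Finset (Fin N)) :
    (scheduling m S)ᵀ * scheduling m S =
      blockDiag fun k => if k ∈ S then (1 : Matrix (Fin m) (Fin m) ℝ) else 0 := by
  have h : (selection S)ᵀ * selection S =
      diagonal fun k => if k ∈ S then (1 : ℝ) else 0 := by
    ext i j
    simp only [mul_apply, transpose_apply, selection, of_apply, diagonal_apply]
    have e := (S.orderIsoOfFin rfl).toEquiv.sum_comp fun y : S =>
      (if i = y then (1 : ℝ) else 0) * if j = y then 1 else 0
    simp only [RelIso.coe_fn_toEquiv, Finset.coe_orderIsoOfFin_apply] at e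
    refine e.trans ?_
    rw [Finset.sum_coe_sort S fun y =>
      (if i = y then (1 : ℝ) else 0) * if j = y then 1 else 0]
    simp only [ite_mul, one_mul, zero_mul, Finset.sum_ite_eq, eq_comm (a := j)]
    split_ifs <;> rfl
  rw [scheduling, ← kroneckerMap_transpose, transpose_one, ← mul_kronecker_mul, h]
  ext i j
  simp only [blockDiag_apply, kroneckerMap_apply, diagonal_apply]
  split_ifs <;> simp
end BlockDiag

/-! ### The trajectory and the cost in stacked form -/

theorem Problem.traj_succ (P : Problem n m N) (u : Fin N → Fin m → ℝ) (k : Fin N) :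
    P.traj u k.succ = P.A *ᵥ P.traj u k.castSucc + P.B *ᵥ u k := by
  simp [Problem.traj]

theorem Problem.traj_zero (P : Problem n m N) (u : Fin N → Fin m → ℝ) :
    P.traj u 0 = P.x0 := by
  simp [Problem.traj]

/-- Variation of constants: `x_k = A^k x_0 + ∑_{j < k} A^{k-1-j} B u_j`. -/
theorem Problem.traj_eq (P : Problem n m N) (u : Fin N → Fin m → ℝ) (k : Fin (N + 1)) :
    P.traj u k = P.A ^ (k : ℕ) *ᵥ P.x0 +
      ∑ j : Fin N, if (j : ℕ) < k then P.A ^ ((k : ℕ) - 1 - j) *ᵥ (P.B *ᵥ u j) else 0 := by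
  induction k using Fin.induction with
  | zero => simp [Problem.traj_zero]
  | succ k ih =>
    have h : ∀ j : Fin N, (if (j : ℕ) < k.succ then
          P.A ^ ((k.succ : ℕ) - 1 - j) *ᵥ (P.B *ᵥ u j) else 0) =
        P.A *ᵥ (if (j : ℕ) < k.castSucc then
          P.A ^ ((k.castSucc : ℕ) - 1 - j) *ᵥ (P.B *ᵥ u j) else 0) +
        if j = k then P.B *ᵥ u j else 0 := by
      intro j
      rcases lt_trichotomy j k with hj | rfl | hj
      · have hj' : (j : ℕ) < k := hj
        have e : (k : ℕ) - j = (k - 1 - j) + 1 := by omega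
        simp [hj.ne, hj', Nat.lt_succ_of_lt hj', e, pow_succ', mulVec_mulVec, Matrix.mul_assoc]
      · simp
      · have hj' : (k : ℕ) < j := hj
        have h1 : ¬ (j : ℕ) < k := by omega
        have h2 : ¬ (j : ℕ) < k + 1 := by omega
        simp [hj.ne', h1, h2]
    rw [Problem.traj_succ, ih]
    simp_rw [h]
    rw [Finset.sum_add_distrib, ← mulVec_sum, mulVec_add, mulVec_mulVec, ← pow_succ']
    simp [add_assoc]

/-- The states `x_1, …, x_N` are the blocks of `Ψ x_0 + Φ B̄ u`. -/
theorem Problem.traj_succ_apply (P : Problem n m N) (u : Fin N → Fin m → ℝ) (k : Fin N)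
    (i : Fin n) : P.traj u k.succ i =
      (P.Psi *ᵥ P.x0 + (P.Phi * P.Bbar) *ᵥ Function.uncurry u) (k, i) := by
  have hB : P.Bbar = blockDiag fun _ => P.B := by
    ext i j; simp [Problem.Bbar, blockDiag_apply, one_apply]
  rw [Problem.traj_eq, ← mulVec_mulVec, Pi.add_apply, Pi.add_apply, Finset.sum_apply]
  congr 1
  rw [hB]
  rw [mulVec, dotProduct, Fintype.sum_prod_type]
  simp only [Problem.Phi, of_apply]
  refine Finset.sum_congr rfl fun j _ => ?_
  have : ∀ x, (blockDiag (fun _ : Fin N => P.B) *ᵥ Function.uncurry u) (j, x) = (P.B *ᵥ u j) x :=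
    fun x => by rw [blockDiag_mulVec]; rfl
  by_cases hj : j ≤ k
  · have hj' : (j : ℕ) ≤ k := hj
    simp only [hj, this]
    simp [Nat.lt_succ_of_le hj', mulVec, dotProduct]
  · have hj' : ¬ (j : ℕ) ≤ k := hj
    simp [hj, hj']

theorem Problem.cost_eq (P : Problem n m N) (u : Fin N → Fin m → ℝ) :
    P.cost u = P.x0 ⬝ᵥ (P.Q 0 *ᵥ P.x0) +
      (P.Psi *ᵥ P.x0 + (P.Phi * P.Bbar) *ᵥ Function.uncurry u) ⬝ᵥ
        (P.Qbar *ᵥ (P.Psi *ᵥ P.x0 + (P.Phi * P.Bbar) *ᵥ Function.uncurry u)) +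
      Function.uncurry u ⬝ᵥ (P.Rbar *ᵥ Function.uncurry u) := by
  -- The cost pairs the states `x_0, …, x_{N-1}` and `x_N`; `Ψ` and `Φ` need `x_0` and `x_1, …, x_N`.
  set g : Fin (N + 1) → ℝ := fun k => P.traj u k ⬝ᵥ (P.Q k *ᵥ P.traj u k) with hg
  have h : g (Fin.last N) + ∑ k : Fin N, g k.castSucc = g 0 + ∑ k : Fin N, g k.succ := by
    rw [← Fin.sum_univ_succ, Fin.sum_univ_castSucc, add_comm]
  have h0 : g 0 = P.x0 ⬝ᵥ (P.Q 0 *ᵥ P.x0) := by simp [hg, Problem.traj_zero]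
  rw [Problem.Qbar, Problem.Rbar, dotProduct_blockDiag_mulVec, dotProduct_blockDiag_mulVec,
    Problem.cost, Finset.sum_add_distrib, ← add_assoc]
  change g (Fin.last N) + ∑ k : Fin N, g k.castSucc + _ = _
  rw [h, h0]
  simp only [hg]
  congr 2
  refine Finset.sum_congr rfl fun k _ => ?_
  have : P.traj u k.succ = fun i =>
    (P.Psi *ᵥ P.x0 + (P.Phi * P.Bbar) *ᵥ Function.uncurry u) (k, i) :=
    funext (P.traj_succ_apply u k)
  rw [this]

/-! ### The matrices `K(S)` and bounds on the gain -/

/-- The map `Q̄^{1/2} Φ B̄` from the stacked inputs to the stacked weighted states. -/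
def Problem.inputMap (P : Problem n m N) : Matrix (Fin N × Fin n) (Fin N × Fin m) ℝ :=
  P.sqrtQbar * P.Phi * P.Bbar

/-- The stacked weighted states `Q̄^{1/2} Ψ x_0` of the uncontrolled trajectory. -/
def Problem.freeState (P : Problem n m N) : Fin N × Fin n → ℝ :=
  P.sqrtQbar *ᵥ (P.Psi *ᵥ P.x0)

/-- The block diagonal matrix with blocks `R_k⁻¹` at the time instants `k ∈ S` and `0` elsewhere:
the inverse of `R̄` on the inputs that vanish outside `S`. -/
def Problem.Rinv (P : Problem n m N) (S : Finset (Fin N)) :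
    Matrix (Fin N × Fin m) (Fin N × Fin m) ℝ :=
  blockDiag fun k => if k ∈ S then (P.R k)⁻¹ else 0

/-- The part of the cost that depends on the input. -/
def Problem.inputCost (P : Problem n m N) (u : Fin N × Fin m → ℝ) : ℝ :=
  (P.freeState + P.inputMap *ᵥ u) ⬝ᵥ (P.freeState + P.inputMap *ᵥ u) + u ⬝ᵥ (P.Rbar *ᵥ u)

section
variable (P : Problem n m N)

theorem Problem.sqrtQbar_nonneg : 0 ≤ P.sqrtQbar := CFC.sqrt_nonneg _

theorem Problem.sqrtQbar_transpose : P.sqrtQbarᵀ = P.sqrtQbar :=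
  transpose_eq_of_nonneg P.sqrtQbar_nonneg

theorem Problem.Rbar_nonneg (hR : ∀ k, (P.R k).PosDef) : 0 ≤ P.Rbar :=
  nonneg_iff_posSemidef.2 (blockDiag_posSemidef fun k => (hR k).posSemidef)

theorem Problem.Rinv_posSemidef (hR : ∀ k, (P.R k).PosDef) (S : Finset (Fin N)) :
    (P.Rinv S).PosSemidef := by
  refine blockDiag_posSemidef fun k => ?_
  split_ifs
  · exact (hR k).inv.posSemidef
  · exact .zero

theorem Problem.isUnit_det_R (hR : ∀ k, (P.R k).PosDef) (k : Fin N) : IsUnit (P.R k).det :=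
  (Matrix.isUnit_iff_isUnit_det _).1 (hR k).isUnit

theorem Problem.Rinv_mul_Rbar_mul_Rinv (hR : ∀ k, (P.R k).PosDef) (S : Finset (Fin N)) :
    P.Rinv S * P.Rbar * P.Rinv S = P.Rinv S := by
  rw [Problem.Rinv, Problem.Rbar, blockDiag_mul, blockDiag_mul]
  congr 1; ext1 k
  split_ifs
  · rw [nonsing_inv_mul _ (P.isUnit_det_R hR k), one_mul]
  · simp

theorem Problem.Rinv_mulVec_Rbar_mulVec (hR : ∀ k, (P.R k).PosDef) (S : Finset (Fin N))
    {u : Fin N → Fin m → ℝ} (hu : ∀ k, k ∉ S → u k = 0) :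
    P.Rinv S *ᵥ (P.Rbar *ᵥ Function.uncurry u) = Function.uncurry u := by
  rw [mulVec_mulVec, Problem.Rinv, Problem.Rbar, blockDiag_mul]
  ext ⟨k, i⟩
  rw [blockDiag_mulVec]
  by_cases hk : k ∈ S
  · simp [hk, nonsing_inv_mul _ (P.isUnit_det_R hR k)]
  · simp [hk, hu k hk]

theorem Problem.K_eq (hR : ∀ k, (P.R k).PosDef) (S : Finset (Fin N)) :
    P.K S = P.inputMap * P.Rinv S * P.inputMapᵀ := by
  have h : P.Rinv S = (scheduling m S)ᵀ * scheduling m S * P.Rbar⁻¹ *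
      ((scheduling m S)ᵀ * scheduling m S) := by
    rw [scheduling_transpose_mul_self, Problem.Rbar, blockDiag_inv (P.isUnit_det_R hR),
      blockDiag_mul, blockDiag_mul, Problem.Rinv]
    congr 1; ext1 k
    split_ifs <;> simp
  rw [h, Problem.K, Problem.inputMap]
  simp only [transpose_mul, P.sqrtQbar_transpose, Matrix.mul_assoc]

theorem Problem.Rinv_eq_sum (S : Finset (Fin N)) : P.Rinv S = ∑ ω ∈ S, P.Rinv {ω} := by
  ext i j
  simp only [Problem.Rinv, blockDiag_apply, Matrix.sum_apply, Finset.mem_singleton]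
  split_ifs with h1 h2
  · rw [Finset.sum_eq_single_of_mem i.1 h2]
    · simp
    · intro b _ hb; simp [hb.symm]
  · rw [Finset.sum_eq_zero]; · rfl
    intro b hb
    have : i.1 ≠ b := fun h => h2 (h ▸ hb)
    simp [this]
  · simp

theorem Problem.K_eq_sum (hR : ∀ k, (P.R k).PosDef) (S : Finset (Fin N)) :
    P.K S = ∑ ω ∈ S, P.K {ω} := by
  simp only [P.K_eq hR]
  rw [P.Rinv_eq_sum, Matrix.mul_sum, Matrix.sum_mul]

theorem Problem.K_nonneg (hR : ∀ k, (P.R k).PosDef) (S : Finset (Fin N)) : 0 ≤ P.K S := by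
  rw [P.K_eq hR, nonneg_iff_posSemidef]
  simpa using (P.Rinv_posSemidef hR S).mul_mul_conjTranspose_same P.inputMap

theorem Problem.K_mono (hR : ∀ k, (P.R k).PosDef) {S T : Finset (Fin N)} (h : S ⊆ T) :
    P.K S ≤ P.K T := by
  rw [P.K_eq_sum hR, P.K_eq_sum hR T]
  exact Finset.sum_le_sum_of_subset_of_nonneg h fun ω _ _ => P.K_nonneg hR _

theorem Problem.one_add_K_isHermitian (hR : ∀ k, (P.R k).PosDef) (S : Finset (Fin N)) :
    (1 + P.K S).IsHermitian :=
  isHermitian_one.add (nonneg_iff_posSemidef.1 (P.K_nonneg hR S)).isHermitian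

theorem Problem.trace_L_mul_K (S : Finset (Fin N)) :
    (P.L * P.K S).trace = P.freeState ⬝ᵥ (P.K S *ᵥ P.freeState) := by
  have h : P.L = vecMulVec P.freeState P.freeState := by
    rw [Problem.L, mul_vecMulVec, vecMulVec_mul, vecMulVec_mul, vecMul_transpose,
      ← P.sqrtQbar_transpose, vecMul_transpose, P.sqrtQbar_transpose, ← mulVec_mulVec,
      Problem.freeState]
  rw [h, vecMulVec_mul, trace_vecMulVec, dotProduct_mulVec, dotProduct_comm]

theorem Problem.trace_nonneg (hR : ∀ k, (P.R k).PosDef) (S : Finset (Fin N)) :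
    0 ≤ (P.L * P.K S).trace := by
  rw [P.trace_L_mul_K]
  exact dotProduct_mulVec_nonneg_of_nonneg (P.K_nonneg hR S) _

theorem Problem.trace_eq_sum (hR : ∀ k, (P.R k).PosDef) (S : Finset (Fin N)) :
    (P.L * P.K S).trace = ∑ ω ∈ S, (P.L * P.K {ω}).trace := by
  rw [P.K_eq_sum hR, Matrix.mul_sum, Matrix.trace_sum]

theorem Problem.cost_eq_inputCost (hQ : ∀ k, (P.Q k).PosSemidef) (u : Fin N → Fin m → ℝ) :
    P.cost u = P.x0 ⬝ᵥ (P.Q 0 *ᵥ P.x0) + P.inputCost (Function.uncurry u) := by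
  have h : P.Qbar = P.sqrtQbar * P.sqrtQbar :=
    (CFC.sqrt_mul_sqrt_self _ (nonneg_iff_posSemidef.2
      (blockDiag_posSemidef fun k => hQ k.succ))).symm
  have h2 : P.freeState + P.inputMap *ᵥ Function.uncurry u =
      P.sqrtQbar *ᵥ (P.Psi *ᵥ P.x0 + (P.Phi * P.Bbar) *ᵥ Function.uncurry u) := by
    rw [mulVec_add, Problem.freeState, Problem.inputMap, Matrix.mul_assoc,
      mulVec_mulVec (Function.uncurry u) P.sqrtQbar]
  rw [P.cost_eq, Problem.inputCost, h2,
    dotProduct_mulVec_comm_of_transpose_eq P.sqrtQbar_transpose,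
    mulVec_mulVec _ P.sqrtQbar P.sqrtQbar, ← h, add_assoc]

theorem Problem.J_empty (hQ : ∀ k, (P.Q k).PosSemidef) :
    P.J ∅ = P.x0 ⬝ᵥ (P.Q 0 *ᵥ P.x0) + P.freeState ⬝ᵥ P.freeState := by
  have h : P.costs ∅ = {P.cost 0} := by
    ext c
    simp only [Problem.costs, Finset.notMem_empty, not_false_eq_true, forall_const,
      Set.mem_ofPred_eq, Set.mem_singleton_iff]
    constructor
    · rintro ⟨u, hu, rfl⟩
      rw [show u = 0 from funext hu]
    · rintro rfl
      exact ⟨0, fun _ => rfl, rfl⟩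
  have h0 : Function.uncurry (0 : Fin N → Fin m → ℝ) = 0 := rfl
  rw [Problem.J, h, csInf_singleton, P.cost_eq_inputCost hQ, Problem.inputCost, h0]
  simp

/-- If every eigenvalue of `1 + K(S)` is at least `μ`, then the gain of `S` is at most the
`1 / μ`-fold first-order gain. -/
theorem Problem.f_le (hQ : ∀ k, (P.Q k).PosSemidef) (hR : ∀ k, (P.R k).PosDef)
    {S : Finset (Fin N)} {μ : ℝ} (hμ : 0 < μ) (h : μ • 1 ≤ 1 + P.K S) :
    P.f S ≤ (P.L * P.K S).trace / μ := by
  have hJ : P.x0 ⬝ᵥ (P.Q 0 *ᵥ P.x0) + (P.freeState ⬝ᵥ P.freeState -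
      (P.freeState ⬝ᵥ (P.K S *ᵥ P.freeState)) / μ) ≤ P.J S := by
    refine le_csInf (P.costs_nonempty S) ?_
    rintro c ⟨u, hu, rfl⟩
    obtain ⟨y, hy⟩ := exists_dual_ge (P.K_nonneg hR S) hμ h P.freeState
    have := dual_le_cost P.inputMap (P.Rbar_nonneg hR)
      (transpose_eq_of_nonneg (nonneg_iff_posSemidef.2 (P.Rinv_posSemidef hR S)))
      (P.Rinv_mul_Rbar_mul_Rinv hR S) P.freeState y _ (P.Rinv_mulVec_Rbar_mulVec hR S hu)
    rw [P.cost_eq_inputCost hQ, Problem.inputCost]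
    rw [← P.K_eq hR] at this
    linarith
  rw [Problem.f, P.J_empty hQ, P.trace_L_mul_K]
  linarith

/-- If every eigenvalue of `1 + K(S)` is at most `Λ`, then the gain of `S` is at least the
`1 / Λ`-fold first-order gain. -/
theorem Problem.le_f (hQ : ∀ k, (P.Q k).PosSemidef) (hR : ∀ k, (P.R k).PosDef)
    {S : Finset (Fin N)} {Λ : ℝ} (hΛ : 0 < Λ) (h : 1 + P.K S ≤ Λ • 1) :
    (P.L * P.K S).trace / Λ ≤ P.f S := by
  set q : Fin N × Fin m → ℝ := -Λ⁻¹ • P.Rinv S *ᵥ (P.inputMapᵀ *ᵥ P.freeState) with hq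
  have hJ : P.J S ≤ P.cost (Function.curry q) := by
    refine csInf_le (P.costs_bddBelow hQ hR S) ⟨_, fun k hk => ?_, rfl⟩
    ext i
    rw [Function.curry_apply, hq, Pi.smul_apply, Problem.Rinv, blockDiag_mulVec]
    simp [hk]
  have hstep := gradient_step_le (P.K_nonneg hR S) hΛ h P.freeState
  rw [P.K_eq hR, ← cost_gradient_input P.inputMap
    (transpose_eq_of_nonneg (nonneg_iff_posSemidef.2 (P.Rinv_posSemidef hR S)))
      (P.Rinv_mul_Rbar_mul_Rinv hR S) P.freeState, ← P.K_eq hR, ← hq] at hstep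
  rw [P.cost_eq_inputCost hQ, Problem.inputCost, Function.uncurry_curry] at hJ
  rw [Problem.f, P.J_empty hQ, P.trace_L_mul_K]
  linarith

end

/-! ### The approximation guarantee -/

theorem GreedyRun.card_eq {f : Finset (Fin N) → ℝ} {d : ℕ} {S : Finset (Fin N)}
    (h : GreedyRun f d S) : S.card = d := by
  induction h with
  | init => rfl
  | step _ hω _ ih => rw [Finset.union_comm, ← Finset.insert_eq, Finset.card_insert_of_notMem hω, ih]

/-- For `α ≥ 0` the factor is at most its limit at `α = 0`. -/
theorem approxFactor_le {α γ : ℝ} (hα : 0 ≤ α) : approxFactor α γ ≤ γ := by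
  unfold approxFactor
  split_ifs with h
  · exact le_rfl
  · have hpos : 0 < α := lt_of_le_of_ne hα (Ne.symm h)
    have := Real.add_one_le_exp (-(α * γ))
    rw [one_div, inv_mul_le_iff₀ hpos]
    linarith

/-- Every set `S` attains the fraction `γ` of the gain of any set `T` that is not larger. The first
two conclusions make `α = 1 - γ` nonnegative and allow the factor to be compared with `γ`. -/
theorem Problem.gammaLow_mul_le (P : Problem n m N)
    (hQ : ∀ k, (P.Q k).PosSemidef) (hR : ∀ k, (P.R k).PosDef)
    (hLK : ∃ ω : Fin N, (P.L * P.K {ω}).trace ≠ 0)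
    {S T : Finset (Fin N)} (hST : T.card ≤ S.card) :
    P.gammaLow ≤ 1 ∧ 0 ≤ P.f T ∧ P.gammaLow * P.f T ≤ P.f S := by
  obtain ⟨ω₀, hω₀⟩ := hLK
  have : Nonempty (Fin N) := ⟨ω₀⟩
  -- Without this, the spectra would be empty and the extreme eigenvalues the junk value `0`.
  have : Nonempty (Fin N × Fin n) := by
    by_contra hne
    rw [not_nonempty_iff] at hne
    exact hω₀ (by simp [Matrix.trace])
  set t : Fin N → ℝ := fun ω => (P.L * P.K {ω}).trace with ht
  set a := ⨅ ω, t ω with ha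
  set b := ⨆ ω, t ω with hb
  set μ := ⨅ ω : Fin N, minEigenvalue (1 + P.K {ω}) with hμ
  set Λ := maxEigenvalue (1 + P.K Finset.univ) with hΛ
  have ht0 : ∀ ω, 0 ≤ t ω := fun ω => P.trace_nonneg hR _
  have hat : ∀ ω, a ≤ t ω := fun ω => ciInf_le (Set.finite_range _).bddBelow ω
  have htb : ∀ ω, t ω ≤ b := fun ω => le_ciSup (Set.finite_range _).bddAbove ω
  have ha0 : 0 ≤ a := le_ciInf ht0
  have hb0 : 0 < b := lt_of_lt_of_le (lt_of_le_of_ne (ht0 ω₀) hω₀.symm) (htb ω₀)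
  have hone : ∀ S, 1 ≤ 1 + P.K S := fun S => le_add_of_nonneg_right (P.K_nonneg hR S)
  have hΛle : ∀ S, 1 + P.K S ≤ Λ • 1 := fun S =>
    (add_le_add_right (P.K_mono hR (Finset.subset_univ S)) 1).trans
      (le_maxEigenvalue_smul_one (P.one_add_K_isHermitian hR _))
  have hμle : ∀ S : Finset (Fin N), S.Nonempty → μ • 1 ≤ 1 + P.K S := by
    rintro S ⟨ω, hω⟩
    calc μ • (1 : Matrix (Fin N × Fin n) (Fin N × Fin n) ℝ)
        ≤ minEigenvalue (1 + P.K {ω}) • 1 :=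
          smul_le_smul_of_nonneg_right (ciInf_le (Set.finite_range _).bddBelow ω) zero_le_one
      _ ≤ 1 + P.K {ω} := minEigenvalue_smul_one_le (P.one_add_K_isHermitian hR _)
      _ ≤ 1 + P.K S := add_le_add_right (P.K_mono hR (by simpa using hω)) 1
  have hμ1 : 1 ≤ μ := by
    refine le_ciInf fun ω => ?_
    have hs := ContinuousFunctionalCalculus.spectrum_nonempty (R := ℝ) (1 + P.K {ω})
      (P.one_add_K_isHermitian hR {ω}).isSelfAdjoint
    refine le_csInf hs ?_
    refine (algebraMap_le_iff_le_spectrum (R := ℝ)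
      (P.one_add_K_isHermitian hR {ω}).isSelfAdjoint).1 ?_
    rw [map_one]
    exact hone _
  have hμΛ : μ ≤ Λ := by
    have h1 : μ • (1 : Matrix (Fin N × Fin n) (Fin N × Fin n) ℝ) ≤ Λ • 1 :=
      (hμle {ω₀} (by simp)).trans (hΛle _)
    rw [← sub_nonneg, ← sub_smul, nonneg_iff_posSemidef] at h1
    have := h1.diag_nonneg (i := Classical.arbitrary _)
    simpa using this
  have hμ0 : 0 < μ := by linarith
  have hΛ0 : 0 < Λ := by linarith
  have hγ : P.gammaLow = a / b * (μ / Λ) ^ 2 := by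
    rw [Problem.gammaLow]
    change a * μ ^ 2 / (b * Λ ^ 2) = _
    field_simp
  have hab : a / b ≤ 1 := (div_le_one hb0).2 ((hat ω₀).trans (htb ω₀))
  have hr : μ / Λ ≤ 1 := (div_le_one hΛ0).2 hμΛ
  have hr0 : 0 ≤ μ / Λ := by positivity
  have hab0 : 0 ≤ a / b := by positivity
  have hfT0 : 0 ≤ P.f T :=
    le_trans (div_nonneg (P.trace_nonneg hR T) hΛ0.le) (P.le_f hQ hR hΛ0 (hΛle T))
  refine ⟨?_, hfT0, ?_⟩
  · rw [hγ]
    exact mul_le_one₀ hab (by positivity) (pow_le_one₀ hr0 hr)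
  have hfS : (S.card * a) / Λ ≤ P.f S := by
    refine le_trans ?_ (P.le_f hQ hR hΛ0 (hΛle S))
    rw [P.trace_eq_sum hR]
    gcongr
    simpa using Finset.card_nsmul_le_sum S t a fun ω _ => hat ω
  have hfT : P.f T ≤ (S.card * b) / μ := by
    rcases T.eq_empty_or_nonempty with rfl | hT
    · have : P.f ∅ = 0 := by simp [Problem.f]
      rw [this]; positivity
    · refine (P.f_le hQ hR hμ0 (hμle T hT)).trans ?_
      rw [P.trace_eq_sum hR]
      gcongr
      calc ∑ ω ∈ T, t ω ≤ T.card * b := by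
            simpa using Finset.sum_le_card_nsmul T t b fun ω _ => htb ω
        _ ≤ S.card * b := by gcongr
  calc P.gammaLow * P.f T ≤ a / b * (μ / Λ) * P.f T := by
        rw [hγ]
        gcongr
        exact pow_le_of_le_one hr0 hr two_ne_zero
    _ ≤ a / b * (μ / Λ) * ((S.card * b) / μ) := by gcongr
    _ = (S.card * a) / Λ := by field_simp
    _ ≤ P.f S := hfS

end SparseLQR

end

theorem corollary1 {n m N : ℕ} (P : SparseLQR.Problem n m N)
    (hQ : ∀ k, (P.Q k).PosSemidef) (hR : ∀ k, (P.R k).PosDef)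
    (hLK : ∃ ω : Fin N, (P.L * P.K {ω}).trace ≠ 0)
    (d : ℕ) (hd : d ≤ N) (Sg Sopt : Finset (Fin N))
    (hSg : SparseLQR.GreedyRun P.f d Sg) (hSopt : SparseLQR.IsOptimal P.f d Sopt) :
    P.f Sg ≥ SparseLQR.approxFactor P.alphaUp P.gammaLow * P.f Sopt := by
  obtain ⟨hγ, hf, h⟩ := P.gammaLow_mul_le hQ hR hLK (hSopt.1.trans_eq hSg.card_eq.symm)
  exact (mul_le_mul_of_nonneg_right (SparseLQR.approxFactor_le (sub_nonneg.2 hγ)) hf).trans h
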